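/- Let $X$ be a metric space and let $A,B\subseteq X$ be subsets with $X=A\cup B$, regarded as metric spaces with the restricted metric. Then $$ad(X)=\max\bigl(ad(A),ad(B)\bigr)$$ in $\{0,1,2,\dots\}\cup\{\infty\}$, where $ad$ is the minor asymptotic dimension, defined as follows. For a family $\mathcal U$ of subsets of a metric space $Y$, its multiplicity is the supremum over $y\in Y$ of the number of elements of $\mathcal U$ containing $y$, and its Lebesgue number is $$L(\mathcal U,Y)=\inf_{y\in Y}\ \sup_{U\in\mathcal U}\operatorname{dist}(y,Y\setminus U)\in[0,\infty],\qquad \operatorname{dist}(y,\emptyset)=\infty .$$ A family $\mathcal V$ refines $\mathcal U$ if every element of $\mathcal V$ is contained in some element of $\mathcal U$. For an integer $n\ge 0$, let $L^n(\mathcal U,Y)$ be the supremum of those $t\in[0,\infty]$ such that $\mathcal U$ has a refinement of multiplicity at most $n+1$ and Lebesgue number at least $t$. Then $ad(Y)$ is the smallest integer $n\ge 0$ such that $L^n(\mathcal U_k,Y)\to\infty$ as $k\to\infty$ for every sequence $(\mathcal U_k)$ of finite covers of $Y$ with $L(\mathcal U_k,Y)\to\infty$, and $ad(Y)=\infty$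 if there is no such $n$. -/

import Mathlib

open scoped ENNReal

namespace CoarseDim

/-- The local Lebesgue number `L_𝒰(x) = sup {dist(x, X \ U) | U ∈ 𝒰}`, with values in `[0, ∞]`.
The extended distance to the empty set is `∞`, so this is `∞` if `X ∈ 𝒰`. -/
noncomputable def localLebesgueNumber {X : Type*} [MetricSpace X] (𝒰 : Set (Set X)) (x : X) :
    ℝ≥0∞ :=
  ⨆ U ∈ 𝒰, Metric.infEDist x Uᶜ

/-- The Lebesgue number `L(𝒰, X) = inf {L_𝒰(x) | x ∈ X}` of a family of subsets of `X`. -/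
noncomputable def lebesgueNumber {X : Type*} [MetricSpace X] (𝒰 : Set (Set X)) : ℝ≥0∞ :=
  ⨅ x : X, localLebesgueNumber 𝒰 x

/-- The multiplicity function: the number of elements of the family containing `x`. -/
noncomputable def multiplicityAt {X : Type*} (𝒰 : Set (Set X)) (x : X) : ℕ∞ :=
  {U | U ∈ 𝒰 ∧ x ∈ U}.encard

/-- The (global) multiplicity of a family of subsets of `X`. -/
noncomputable def multiplicity {X : Type*} (𝒰 : Set (Set X)) : ℕ∞ :=
  ⨆ x : X, multiplicityAt 𝒰 x

/-- `𝒱` refines `𝒰`: every element of `𝒱` is contained in an element of `𝒰`. -/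
def Refines {X : Type*} (𝒱 𝒰 : Set (Set X)) : Prop :=
  ∀ V ∈ 𝒱, ∃ U ∈ 𝒰, V ⊆ U

/-- The `n`-th Lebesgue number `L^n(𝒰, X)`: the supremum of those `t ∈ [0, ∞]` such that `𝒰` has a
refinement of multiplicity at most `n + 1` and Lebesgue number at least `t`. -/
noncomputable def higherLebesgueNumber {X : Type*} [MetricSpace X] (n : ℕ) (𝒰 : Set (Set X)) :
    ℝ≥0∞ :=
  sSup {t : ℝ≥0∞ | ∃ 𝒱 : Set (Set X),
    Refines 𝒱 𝒰 ∧ multiplicity 𝒱 ≤ (n : ℕ∞) + 1 ∧ t ≤ lebesgueNumber 𝒱}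

/-- A finite cover of `X`. -/
def IsFiniteCover {X : Type*} (𝒰 : Set (Set X)) : Prop :=
  𝒰.Finite ∧ ⋃₀ 𝒰 = Set.univ

/-- The function `𝒰 ↦ L^n(𝒰, X)` is coarsely proper on the space of finite covers of `X`: it tends
to infinity along every sequence of finite covers that diverges to infinity, that is, whose
Lebesgue numbers tend to infinity. -/
def HigherLebesgueCoarselyProper (X : Type*) [MetricSpace X] (n : ℕ) : Prop :=
  ∀ 𝒰 : ℕ → Set (Set X), (∀ k, IsFiniteCover (𝒰 k)) →
    Filter.Tendsto (fun k => lebesgueNumber (𝒰 k)) Filter.atTop (nhds ⊤) →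
    Filter.Tendsto (fun k => higherLebesgueNumber n (𝒰 k)) Filter.atTop (nhds ⊤)

/-- The minor asymptotic dimension `ad(X)`: the smallest integer `n ≥ 0` such that
`𝒰 ↦ L^n(𝒰, X)` is coarsely proper on the space of finite covers of `X`, and `∞` if there is no
such `n`. -/
noncomputable def minorAsymptoticDim (X : Type*) [MetricSpace X] : ℕ∞ :=
  ⨅ (n : ℕ) (_ : HigherLebesgueCoarselyProper X n), (n : ℕ∞)

end CoarseDim

/-!
Coarse properness of `𝒰 ↦ L^n(𝒰, X)` has a uniform form: for every scale `r` there is a scale `s`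
such that every finite cover containing all `s`-balls can be shrunk, member by member, to a cover
of multiplicity at most `n + 1` containing all `r`-balls. This form can be relativised to a subset
`A` of `X` by bounding the multiplicity only at the points of `A`, and the relative property of `A`
in `X` agrees with the absolute property of `A`. As shrinking further never raises a multiplicity,
shrinking first for `A` and then for `B` bounds the multiplicity on `A ∪ B`.
-/

namespace CoarseDim

open Filter Metric Set
open scoped NNReal

variable {X Y ι κ : Type*}

section Multiplicity

/-- Multiplicity bound on a subset for an indexed family: each point of `A` lies in `U i` for at
most `m` indices `i`. Indices are counted rather than sets, so that a bound passes to every family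
with smaller members. -/
def MultiplicityLEOn (A : Set X) (U : ι → Set X) (m : ℕ∞) : Prop :=
  ∀ x ∈ A, {i | x ∈ U i}.encard ≤ m

variable {A B : Set X} {U V : ι → Set X} {m : ℕ∞}

lemma MultiplicityLEOn.mono_family (h : MultiplicityLEOn A U m) (hVU : V ≤ U) :
    MultiplicityLEOn A V m :=
  fun x hx => (encard_le_encard fun i hi => hVU i hi).trans (h x hx)

lemma MultiplicityLEOn.union (hA : MultiplicityLEOn A U m) (hB : MultiplicityLEOn B U m) :
    MultiplicityLEOn (A ∪ B) U m :=
  fun x hx => hx.elim (hA x) (hB x)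

lemma multiplicityLEOn_coe {𝒱 : Set (Set X)} (h : multiplicity 𝒱 ≤ m) :
    MultiplicityLEOn A ((↑) : 𝒱 → Set X) m := fun x _ =>
  calc {V : 𝒱 | x ∈ (V : Set X)}.encard
    _ ≤ multiplicityAt 𝒱 x :=
      encard_le_encard_of_injOn (fun V hV => ⟨V.2, hV⟩) Subtype.val_injective.injOn
    _ ≤ multiplicity 𝒱 := le_iSup (multiplicityAt 𝒱) x
    _ ≤ m := h

lemma MultiplicityLEOn.multiplicity_range_le (h : MultiplicityLEOn univ U m) :
    multiplicity (range U) ≤ m := by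
  refine iSup_le fun x => ?_
  have hsub : {W | W ∈ range U ∧ x ∈ W} ⊆ U '' {i | x ∈ U i} := by
    rintro _ ⟨⟨i, rfl⟩, hx⟩
    exact ⟨i, hx, rfl⟩
  exact (encard_le_encard hsub).trans ((encard_image_le _ _).trans (h x (mem_univ x)))

end Multiplicity

section MergeAlong

/-- The family obtained from `V` by uniting, for each `i`, the members whose index is sent to `i`
by `f`. It turns a refinement of `U`, with `f` a choice of containing members, into a family
indexed like `U`. -/
def mergeAlong (f : κ → ι) (V : κ → Set X) (i : ι) : Set X :=
  ⋃ (k) (_ : f k = i), V k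

variable {f : κ → ι} {V : κ → Set X}

lemma subset_mergeAlong (k : κ) : V k ⊆ mergeAlong f V (f k) :=
  subset_iUnion₂_of_subset k rfl subset_rfl

lemma mergeAlong_le {U : ι → Set X} (h : ∀ k, V k ⊆ U (f k)) : mergeAlong f V ≤ U := by
  refine fun i => iUnion₂_subset ?_
  rintro k rfl
  exact h k

protected lemma MultiplicityLEOn.mergeAlong {A : Set X} {m : ℕ∞} (h : MultiplicityLEOn A V m) :
    MultiplicityLEOn A (mergeAlong f V) m := by
  intro x hx
  have hsub : {i | x ∈ mergeAlong f V i} ⊆ f '' {k | x ∈ V k} := by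
    intro i hi
    obtain ⟨k, hk, hxk⟩ := mem_iUnion₂.1 hi
    exact ⟨k, hxk, hk⟩
  exact (encard_le_encard hsub).trans ((encard_image_le _ _).trans (h x hx))

end MergeAlong

section CoversBalls

variable [PseudoEMetricSpace X]

/-- Every ball of radius `r` lies in a member of the family `U`. Unlike a lower bound `r` on the
Lebesgue number, this asks for a single member containing the whole ball, not for members
containing every smaller concentric ball. -/
def CoversBalls (U : ι → Set X) (r : ℝ≥0∞) : Prop :=
  ∀ x, ∃ i, eball x r ⊆ U i

lemma CoversBalls.mono {U : ι → Set X} {r s : ℝ≥0∞} (h : CoversBalls U s) (hrs : r ≤ s) :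
    CoversBalls U r := fun x => by
  obtain ⟨i, hi⟩ := h x
  exact ⟨i, (eball_subset_eball hrs).trans hi⟩

lemma CoversBalls.sUnion_range_eq_univ {U : ι → Set X} {r : ℝ≥0∞} (h : CoversBalls U r)
    (hr : 0 < r) : ⋃₀ range U = univ := eq_univ_of_forall fun x => by
  obtain ⟨i, hi⟩ := h x
  exact ⟨U i, mem_range_self i, hi (mem_eball_self hr)⟩

protected lemma CoversBalls.mergeAlong {f : κ → ι} {V : κ → Set X} {r : ℝ≥0∞}
    (h : CoversBalls V r) : CoversBalls (mergeAlong f V) r := fun x => by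
  obtain ⟨k, hk⟩ := h x
  exact ⟨f k, hk.trans (subset_mergeAlong k)⟩

lemma le_infEDist_compl_iff {x : X} {U : Set X} {r : ℝ≥0∞} :
    r ≤ infEDist x Uᶜ ↔ eball x r ⊆ U := by
  rw [le_infEDist, ← compl_subset_compl]
  simp only [subset_def, mem_compl_iff, mem_eball', not_lt]

lemma eball_subset_eball_add {x y : X} {r s : ℝ≥0∞} (hy : y ∈ eball x s) :
    eball x r ⊆ eball y (r + s) := fun z hz =>
  (edist_triangle z x y).trans_lt (ENNReal.add_lt_add hz (mem_eball'.1 hy))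

end CoversBalls

section LebesgueNumber

variable [MetricSpace X]

lemma CoversBalls.le_lebesgueNumber {U : ι → Set X} {r : ℝ≥0∞} (h : CoversBalls U r) :
    r ≤ lebesgueNumber (range U) := le_iInf fun x => by
  obtain ⟨i, hi⟩ := h x
  exact le_iSup₂_of_le (U i) (mem_range_self i) (le_infEDist_compl_iff.2 hi)

lemma coversBalls_of_lt_lebesgueNumber {U : ι → Set X} {r : ℝ≥0∞}
    (h : r < lebesgueNumber (range U)) : CoversBalls U r := fun x => by
  have hx : r < localLebesgueNumber (range U) x := h.trans_le (iInf_le _ x)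
  simp only [localLebesgueNumber, iSup_range, lt_iSup_iff] at hx
  obtain ⟨i, hi⟩ := hx
  exact ⟨i, le_infEDist_compl_iff.1 hi.le⟩

lemma le_higherLebesgueNumber {U V : ι → Set X} {n : ℕ} {r : ℝ≥0∞} (hVU : V ≤ U)
    (hmult : MultiplicityLEOn univ V (n + 1)) (hV : CoversBalls V r) :
    r ≤ higherLebesgueNumber n (range U) := by
  refine le_sSup ⟨range V, ?_, hmult.multiplicity_range_le, hV.le_lebesgueNumber⟩
  rintro _ ⟨i, rfl⟩
  exact ⟨U i, mem_range_self i, hVU i⟩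

lemma exists_shrinking_of_lt_higherLebesgueNumber {U : ι → Set X} {n : ℕ} {r : ℝ≥0∞}
    (h : r < higherLebesgueNumber n (range U)) :
    ∃ V ≤ U, MultiplicityLEOn univ V (n + 1) ∧ CoversBalls V r := by
  obtain ⟨t, ⟨𝒱, hrefines, hmult, ht⟩, hrt⟩ := lt_sSup_iff.1 h
  have hcontained (V : 𝒱) : ∃ i, (V : Set X) ⊆ U i := by
    obtain ⟨_, ⟨i, rfl⟩, hi⟩ := hrefines V V.2
    exact ⟨i, hi⟩
  choose f hf using hcontained
  have hballs : CoversBalls ((↑) : 𝒱 → Set X) r :=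
    coversBalls_of_lt_lebesgueNumber (by rw [Subtype.range_coe]; exact hrt.trans_le ht)
  exact ⟨mergeAlong f (↑), mergeAlong_le hf, (multiplicityLEOn_coe hmult).mergeAlong,
    hballs.mergeAlong⟩

end LebesgueNumber

section UniformlyShrinkableOn

variable [PseudoEMetricSpace X]

/-- The uniform form, relative to a subset `A` of `X`, of the condition defining `ad(X) ≤ n`:
finite covers of `X` of large Lebesgue number can be shrunk to covers whose multiplicity *on `A`*
is at most `n + 1`, keeping a large Lebesgue number on all of `X`. Finite families are indexed by
`Fin m`, which keeps the definition free of universe levels other than that of `X`. -/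
def UniformlyShrinkableOn (A : Set X) (n : ℕ) : Prop :=
  ∀ r : ℝ≥0, ∃ s : ℝ≥0, ∀ (m : ℕ) (U : Fin m → Set X), CoversBalls U s →
    ∃ V ≤ U, MultiplicityLEOn A V (n + 1) ∧ CoversBalls V r

variable {A B : Set X} {m n : ℕ}

lemma UniformlyShrinkableOn.mono_set (h : UniformlyShrinkableOn B n) (hAB : A ⊆ B) :
    UniformlyShrinkableOn A n := by
  intro r
  obtain ⟨s, hs⟩ := h r
  refine ⟨s, fun m U hU => ?_⟩
  obtain ⟨V, hVU, hmult, hV⟩ := hs m U hU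
  exact ⟨V, hVU, fun x hx => hmult x (hAB hx), hV⟩

lemma UniformlyShrinkableOn.mono_dim (h : UniformlyShrinkableOn A m) (hmn : m ≤ n) :
    UniformlyShrinkableOn A n := by
  intro r
  obtain ⟨s, hs⟩ := h r
  refine ⟨s, fun k U hU => ?_⟩
  obtain ⟨V, hVU, hmult, hV⟩ := hs k U hU
  exact ⟨V, hVU, fun x hx => (hmult x hx).trans (by gcongr), hV⟩

lemma UniformlyShrinkableOn.union (hA : UniformlyShrinkableOn A n)
    (hB : UniformlyShrinkableOn B n) : UniformlyShrinkableOn (A ∪ B) n := by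
  intro r
  obtain ⟨s, hs⟩ := hB r
  obtain ⟨t, ht⟩ := hA s
  refine ⟨t, fun m U hU => ?_⟩
  obtain ⟨V, hVU, hVmult, hV⟩ := ht m U hU
  obtain ⟨W, hWV, hWmult, hW⟩ := hs m V hV
  exact ⟨W, hWV.trans hVU, (hVmult.mono_family hWV).union hWmult, hW⟩

lemma uniformlyShrinkableOn_union :
    UniformlyShrinkableOn (A ∪ B) n ↔ UniformlyShrinkableOn A n ∧ UniformlyShrinkableOn B n :=
  ⟨fun h => ⟨h.mono_set subset_union_left, h.mono_set subset_union_right⟩, fun h => h.1.union h.2⟩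

end UniformlyShrinkableOn

section Isometry

variable [PseudoEMetricSpace X] [PseudoEMetricSpace Y] {f : Y → X}

lemma preimage_eball_subset_eball_add (hf : Isometry f) {x : X} {y : Y} {r s : ℝ≥0∞}
    (hy : f y ∈ eball x s) : f ⁻¹' eball x r ⊆ eball y (r + s) :=
  (preimage_mono (eball_subset_eball_add hy)).trans (hf.preimage_eball y _).subset

protected lemma CoversBalls.kernImage [Nonempty Y] (hf : Isometry f) {U : ι → Set Y} {s : ℝ≥0∞}
    (hU : CoversBalls U (s + s)) : CoversBalls (fun i => kernImage f (U i)) s := by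
  intro x
  simp only [subset_kernImage_iff]
  rcases (f ⁻¹' eball x s).eq_empty_or_nonempty with hempty | ⟨y, hy⟩
  · obtain ⟨i, -⟩ := hU (Classical.arbitrary Y)
    exact ⟨i, hempty ▸ empty_subset _⟩
  · obtain ⟨i, hi⟩ := hU y
    exact ⟨i, (preimage_eball_subset_eball_add hf hy).trans hi⟩

/- Shrinking the preimages `f ⁻¹' U i` instead would only control traces on `Y`; the eroded family
keeps whole balls of `X` around `f y` inside `U i`, which `CoversBalls.inter_kernImage` needs. -/
lemma CoversBalls.comap_erosion (hf : Isometry f) {U : ι → Set X} {R s : ℝ≥0∞}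
    (hU : CoversBalls U (R + s)) : CoversBalls (fun i => {y | eball (f y) R ⊆ U i}) s := by
  intro y
  obtain ⟨i, hi⟩ := hU (f y)
  refine ⟨i, fun z hz => (eball_subset_eball_add ?_).trans hi⟩
  rwa [mem_eball, hf.edist_eq, ← mem_eball, mem_eball_comm]

lemma CoversBalls.inter_kernImage (hf : Isometry f) {U : ι → Set X} {V : ι → Set Y} {r : ℝ≥0∞}
    (hU : CoversBalls U r) (hVU : ∀ i, V i ⊆ {y | eball (f y) (r + r) ⊆ U i})
    (hV : CoversBalls V (r + r)) : CoversBalls (fun i => U i ∩ kernImage f (V i)) r := by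
  intro x
  simp only [subset_inter_iff, subset_kernImage_iff]
  rcases (f ⁻¹' eball x r).eq_empty_or_nonempty with hempty | ⟨y, hy⟩
  · obtain ⟨i, hi⟩ := hU x
    exact ⟨i, hi, hempty ▸ empty_subset _⟩
  · obtain ⟨i, hi⟩ := hV y
    have hpre : f ⁻¹' eball x r ⊆ V i := (preimage_eball_subset_eball_add hf hy).trans hi
    exact ⟨i, (eball_subset_eball_add hy).trans (hVU i (hpre hy)), hpre⟩

lemma UniformlyShrinkableOn.univ_of_range (hf : Isometry f) {n : ℕ}
    (h : UniformlyShrinkableOn (range f) n) : UniformlyShrinkableOn (univ : Set Y) n := by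
  intro r
  obtain ⟨s, hs⟩ := h r
  refine ⟨s + s, fun m U hU => ?_⟩
  rcases isEmpty_or_nonempty Y with _ | _
  · exact ⟨U, le_rfl, fun y => isEmptyElim y, fun y => isEmptyElim y⟩
  rw [ENNReal.coe_add] at hU
  obtain ⟨V, hVU, hmult, hV⟩ := hs m (fun i => kernImage f (U i)) (hU.kernImage hf)
  refine ⟨fun i => f ⁻¹' V i, fun i => subset_kernImage_iff.1 (hVU i),
    fun y _ => hmult (f y) (mem_range_self y), fun y => ?_⟩
  obtain ⟨i, hi⟩ := hV (f y)
  exact ⟨i, (hf.preimage_eball y r).superset.trans (preimage_mono hi)⟩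

lemma UniformlyShrinkableOn.range_of_univ (hf : Isometry f) {n : ℕ}
    (h : UniformlyShrinkableOn (univ : Set Y) n) : UniformlyShrinkableOn (range f) n := by
  intro r
  obtain ⟨s, hs⟩ := h (r + r)
  rw [ENNReal.coe_add] at hs
  refine ⟨r + r + s, fun m U hU => ?_⟩
  push_cast at hU
  obtain ⟨V, hVU, hmult, hV⟩ := hs m _ (hU.comap_erosion hf)
  refine ⟨fun i => U i ∩ kernImage f (V i), fun i => inter_subset_left, ?_,
    (hU.mono (by rw [add_assoc]; exact le_self_add)).inter_kernImage hf hVU hV⟩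
  rintro _ ⟨y, rfl⟩
  exact (encard_le_encard fun i hi => hi.2 rfl).trans (hmult y (mem_univ y))

lemma uniformlyShrinkableOn_range_iff (hf : Isometry f) {n : ℕ} :
    UniformlyShrinkableOn (range f) n ↔ UniformlyShrinkableOn (univ : Set Y) n :=
  ⟨.univ_of_range hf, .range_of_univ hf⟩

end Isometry

section MinorAsymptoticDim

variable [MetricSpace X] {n : ℕ}

lemma HigherLebesgueCoarselyProper.uniformlyShrinkableOn_univ
    (h : HigherLebesgueCoarselyProper X n) : UniformlyShrinkableOn (univ : Set X) n := by
  by_contra hnot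
  simp only [UniformlyShrinkableOn, not_forall, not_exists] at hnot
  obtain ⟨r, hr⟩ := hnot
  choose m U hU hbad using fun k : ℕ => hr (k + 1)
  have hcover (k : ℕ) : IsFiniteCover (range (U k)) :=
    ⟨finite_range _, (hU k).sUnion_range_eq_univ (by simp)⟩
  have hdiverges : Tendsto (fun k => lebesgueNumber (range (U k))) atTop (nhds ⊤) :=
    tendsto_nhds_top_mono' ENNReal.tendsto_nat_nhds_top fun k =>
      ((hU k).mono (by simp)).le_lebesgueNumber
  obtain ⟨k, hk⟩ :=
    (ENNReal.tendsto_nhds_top_iff_nnreal.1 (h _ hcover hdiverges) r).exists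
  obtain ⟨V, hV⟩ := exists_shrinking_of_lt_higherLebesgueNumber hk
  exact hbad k V hV

lemma UniformlyShrinkableOn.higherLebesgueCoarselyProper
    (h : UniformlyShrinkableOn (univ : Set X) n) : HigherLebesgueCoarselyProper X n := by
  intro 𝒰 hcover hL
  rw [ENNReal.tendsto_nhds_top_iff_nnreal] at hL ⊢
  intro r
  obtain ⟨s, hs⟩ := h (r + 1)
  filter_upwards [hL s] with k hk
  obtain ⟨m, U, -, hU⟩ := (hcover k).1.fin_param
  rw [← hU] at hk ⊢
  obtain ⟨V, hVU, hmult, hV⟩ := hs m U (coversBalls_of_lt_lebesgueNumber hk)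
  calc (r : ℝ≥0∞) < (r + 1 : ℝ≥0) := by exact_mod_cast lt_add_one r
    _ ≤ higherLebesgueNumber n (range U) := le_higherLebesgueNumber hVU hmult hV

lemma minorAsymptoticDim_le_iff :
    minorAsymptoticDim X ≤ n ↔ UniformlyShrinkableOn (univ : Set X) n := by
  refine ⟨fun h => ?_, fun h => iInf₂_le n h.higherLebesgueCoarselyProper⟩
  have hlt : minorAsymptoticDim X < (n + 1 : ℕ) := h.trans_lt (by exact_mod_cast n.lt_succ_self)
  simp only [minorAsymptoticDim, iInf_lt_iff] at hlt
  obtain ⟨m, hm, hmn⟩ := hlt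
  exact hm.uniformlyShrinkableOn_univ.mono_dim (Nat.lt_succ_iff.1 (by exact_mod_cast hmn))

lemma minorAsymptoticDim_subtype_le_iff {A : Set X} :
    minorAsymptoticDim A ≤ n ↔ UniformlyShrinkableOn A n := by
  rw [minorAsymptoticDim_le_iff, ← uniformlyShrinkableOn_range_iff isometry_subtype_coe,
    Subtype.range_coe]

end MinorAsymptoticDim

lemma eq_of_forall_le_natCast_iff {a b : ℕ∞} (h : ∀ n : ℕ, a ≤ n ↔ b ≤ n) : a = b :=
  eq_of_forall_ge_iff fun c => by
    cases c with
    | top => simp only [le_top]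
    | coe n => exact h n

end CoarseDim

theorem mainTheorem11 {X : Type*} [MetricSpace X] (A B : Set X) (hAB : A ∪ B = Set.univ) :
    CoarseDim.minorAsymptoticDim X =
      max (CoarseDim.minorAsymptoticDim A) (CoarseDim.minorAsymptoticDim B) := by
  refine CoarseDim.eq_of_forall_le_natCast_iff fun n => ?_
  rw [max_le_iff, CoarseDim.minorAsymptoticDim_le_iff,
    CoarseDim.minorAsymptoticDim_subtype_le_iff, CoarseDim.minorAsymptoticDim_subtype_le_iff,
    ← CoarseDim.uniformlyShrinkableOn_union, hAB]
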